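/- Let $X, Y$ be real Banach spaces such that $X^{**}$ or $Y^{**}$ has the compact metric approximation property (the identity operator is a limit, uniformly on compact sets, of compact operators of norm at most $1$). Let $\mathcal L(X,Y^*)$ be the space of bounded operators with the operator norm and $\mathcal K(X,Y^*)$ its subspace of compact operators. A nonzero vector $z$ of a Banach space $Z$ is a smooth point of $Z$ if there is exactly one $f \in Z^*$ with $\|f\| \le 1$ and $f(z) = \|z\|$; it is a very smooth point of $Z$ if it is a smooth point of $Z$ and its canonical image in $Z^{**}$ is a smooth point of $Z^{**}$. Suppose that $A \in \mathcal K(X,Y^*)$ is a very smooth point of $\mathcal K(X,Y^*)$. Then for every $B \in \mathcal L(X,Y^*)$ there exist extreme points $x^{**}$ of the closed unit ball of $X^{**}$ and $y^{**}$ of the closed unit ball of $Y^{**}$ such that $$x^{**}(A^*(y^{**})) = \|A\| \quad\text{and}\quad \lim_{t \to 0^+} \frac{\|A+tB\|-\|A\|}{t} = x^{**}(B^*(y^{**})),$$ where $A^*, B^* : Y^{**} \to X^*$ denote the adjoint operators. -/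

import Mathlib

open Filter Topology

/-- The topological dual `E*` of a real normed space, with the operator norm. -/
local notation:max E "⋆" => StrongDual ℝ E

/-- The adjoint `T* : F* → E*`, `T* g = g ∘ T`, of a bounded operator `T : E → F`. -/
noncomputable def adjointOp {E F : Type*} [NormedAddCommGroup E] [NormedSpace ℝ E]
    [NormedAddCommGroup F] [NormedSpace ℝ F] (T : E →L[ℝ] F) : F⋆ →L[ℝ] E⋆ :=
  ContinuousLinearMap.precomp ℝ T

theorem adjointOp_apply {E F : Type*} [NormedAddCommGroup E] [NormedSpace ℝ E]
    [NormedAddCommGroup F] [NormedSpace ℝ F] (T : E →L[ℝ] F) (g : F⋆) (x : E) :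
    adjointOp T g x = g (T x) := rfl

/-- The space `𝒦(E, F)` of compact operators, a subspace of `ℒ(E, F)` with the operator norm. -/
abbrev CompactOps (E F : Type*) [NormedAddCommGroup E] [NormedSpace ℝ E]
    [NormedAddCommGroup F] [NormedSpace ℝ F] : Submodule ℝ (E →L[ℝ] F) :=
  compactOperator (RingHom.id ℝ) E F

/-- The compact metric approximation property: the identity of `E` is a limit, uniformly on
compact sets, of compact operators of norm at most one. -/
def HasCompactMetricAP (E : Type*) [NormedAddCommGroup E] [NormedSpace ℝ E] : Prop :=
  ∀ K : Set E, IsCompact K → ∀ ε : ℝ, 0 < ε →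
    ∃ T : E →L[ℝ] E, IsCompactOperator T ∧ ‖T‖ ≤ 1 ∧ ∀ x ∈ K, ‖T x - x‖ ≤ ε

/-- The state space `S_x` of a vector: the norming functionals in the dual unit ball. -/
def stateSpace {E : Type*} [NormedAddCommGroup E] [NormedSpace ℝ E] (x : E) : Set E⋆ :=
  {f | ‖f‖ ≤ 1 ∧ f x = ‖x‖}

/-- A smooth point: a nonzero vector whose state space is a singleton. -/
def IsSmoothPoint {E : Type*} [NormedAddCommGroup E] [NormedSpace ℝ E] (x : E) : Prop :=
  x ≠ 0 ∧ ∃ f : E⋆, stateSpace x = {f}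

/-- A very smooth point: a smooth point of `E` which, in the canonical embedding, is also a
smooth point of the bidual `E**`. -/
def IsVerySmoothPoint {E : Type*} [NormedAddCommGroup E] [NormedSpace ℝ E] (x : E) : Prop :=
  IsSmoothPoint x ∧ IsSmoothPoint (NormedSpace.inclusionInDoubleDual ℝ E x)

/-! Very smoothness upgrades approximate norming to weak convergence. Let `f` be the support
functional of `A`. If functionals `u i` in the dual ball satisfy `u i A → ‖A‖`, every pointwise
limit of them in the third dual supports the canonical image of `A`, so it equals the canonical
image of `f`; hence `u i → f` weakly (`IsVerySmoothPoint.tendsto_weak`).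

This is used twice. Compactness gives bidual vectors with `x** ⊗ y**` supporting `A`. Replacing one
factor at a time by a norming sequence from `X` or `Y`, weak convergence puts that factor in the
weakly closed canonical image, so both vectors come from `X` and `Y` (`exists_norming_vectors`).
Uniqueness of the support functional makes them extreme in the bidual balls.

For the derivative, the approximation property provides `J` in the bidual of the compact operators
acting as `B` on tensors `x ⊗ y` (`exists_bidual_of_hasCompactMetricAP`). Pairs almost norming `A +
tB` asymptotically norm `A`, so testing weak convergence against `J` shows that `B` on these pairs
tends to `B x y`, which squeezes the difference quotient. -/

open NormedSpace

/-! ### Duality, weak limits and very smooth points -/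

section NormedSpaces

set_option maxSynthPendingDepth 3

variable {E F : Type*} [NormedAddCommGroup E] [NormedSpace ℝ E]
  [NormedAddCommGroup F] [NormedSpace ℝ F]

/-- **Banach–Alaoglu**: a bounded family of functionals has a pointwise limit along any
ultrafilter. -/
theorem exists_ultrafilter_limit {ι : Type*} (U : Ultrafilter ι) (f : ι → E⋆) (C : ℝ)
    (hf : ∀ i, ‖f i‖ ≤ C) :
    ∃ F : E⋆, ‖F‖ ≤ C ∧ ∀ x, Tendsto (fun i => f i x) U (𝓝 (F x)) := by
  obtain ⟨g, hg, hle⟩ := (WeakDual.isCompact_closedBall (0 : E⋆) C).ultrafilter_le_nhds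
    (U.map fun i => StrongDual.toWeakDual (f i)) (by
      rw [le_principal_iff]
      refine Filter.mem_map.2 (Filter.univ_mem' fun i => ?_)
      simpa using hf i)
  refine ⟨WeakDual.toStrongDual g, by simpa using hg, fun x => ?_⟩
  exact ((WeakDual.eval_continuous x).tendsto g).comp hle

/-- **Schauder's theorem**: the adjoint of a compact operator is compact. -/
theorem IsCompactOperator.adjointOp {T : E →L[ℝ] F} (hT : IsCompactOperator T) :
    IsCompactOperator (adjointOp T) := by
  refine (isCompactOperator_iff_image_closedBall_subset_compact (𝕜₁ := ℝ)
    (_root_.adjointOp T : F⋆ →ₗ[ℝ] E⋆) one_pos).2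
    ⟨(fun g : WeakDual ℝ F => _root_.adjointOp T (WeakDual.toStrongDual g)) ''
      (WeakDual.toStrongDual ⁻¹' Metric.closedBall (0 : F⋆) 1), ?_, ?_⟩
  swap
  · rintro _ ⟨g, hg, rfl⟩
    exact ⟨StrongDual.toWeakDual g, by simpa using hg, rfl⟩
  -- On the dual ball the adjoint is weak*-to-norm continuous: a finite `ε / 4`-net of a compact set
  -- containing the image of the unit ball reduces norm closeness to finitely many evaluations.
  refine (WeakDual.isCompact_closedBall (0 : F⋆) 1).image_of_continuousOn fun g hg => ?_
  have hg1 : ‖WeakDual.toStrongDual g‖ ≤ 1 := by simpa using hg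
  refine Metric.tendsto_nhds.2 fun ε hε => ?_
  obtain ⟨K, hK, hTK⟩ := hT.image_closedBall_subset_compact (f := (T : E →ₗ[ℝ] F)) 1
  obtain ⟨t, ht, hcov⟩ := Metric.totallyBounded_iff.1 hK.totallyBounded (ε / 4) (by positivity)
  have hev : ∀ᶠ h : WeakDual ℝ F in 𝓝[WeakDual.toStrongDual ⁻¹' Metric.closedBall (0 : F⋆) 1] g,
      ∀ y ∈ t, dist (h y) (g y) < ε / 4 :=
    ht.eventually_all.2 fun y _ => Metric.tendsto_nhds.1
      (((WeakDual.eval_continuous y).tendsto g).mono_left nhdsWithin_le_nhds) _ (by positivity)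
  filter_upwards [hev, self_mem_nhdsWithin] with h hh hhb
  have hh1 : ‖WeakDual.toStrongDual h‖ ≤ 1 := by simpa using hhb
  rw [dist_eq_norm, ← map_sub]
  refine lt_of_le_of_lt (b := 3 * ε / 4) ?_ (by linarith)
  refine ContinuousLinearMap.opNorm_le_of_unit_norm (by positivity) fun x hx => ?_
  obtain ⟨y, hy, hxy⟩ := Set.mem_iUnion₂.1
    (hcov (hTK ⟨x, by simp [hx], rfl⟩ : T x ∈ K))
  rw [Metric.mem_ball, dist_eq_norm] at hxy
  have e1 : |h (T x - y)| ≤ ‖T x - y‖ := by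
    simpa using (WeakDual.toStrongDual h).le_of_opNorm_le hh1 (T x - y)
  have e2 : |g (T x - y)| ≤ ‖T x - y‖ := by
    simpa using (WeakDual.toStrongDual g).le_of_opNorm_le hg1 (T x - y)
  have e3 : |h y - g y| < ε / 4 := by simpa [Real.dist_eq] using hh y hy
  rw [map_sub, abs_le] at e1 e2
  rw [abs_lt] at e3
  change |h (T x) - g (T x)| ≤ _
  rw [abs_le]
  constructor <;> linarith

/-- A closed subspace contains the weak limits of its members. -/
theorem Submodule.mem_of_tendsto_weak {ι : Type*} {l : Filter ι} [l.NeBot] (S : Submodule ℝ E)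
    (hS : IsClosed (S : Set E)) {u : ι → E} {z : E} (hu : ∀ i, u i ∈ S)
    (h : ∀ φ : E⋆, Tendsto (fun i => φ (u i)) l (𝓝 (φ z))) : z ∈ S := by
  by_contra hz
  obtain ⟨φ, c, hφ, hc⟩ := geometric_hahn_banach_closed_point S.convex hS hz
  exact absurd (le_of_tendsto (h φ) (Eventually.of_forall fun i => (hφ _ (hu i)).le)) (not_le.2 hc)

theorem isClosed_range_inclusionInDoubleDual [CompleteSpace E] :
    IsClosed ((LinearMap.range (inclusionInDoubleDual ℝ E : E →ₗ[ℝ] E⋆⋆) : Submodule ℝ E⋆⋆) :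
      Set E⋆⋆) := by
  rw [LinearMap.coe_range]
  exact (inclusionInDoubleDualLi (E := E) ℝ).isometry.isUniformInducing.isComplete_range.isClosed

theorem norm_inclusionInDoubleDual (x : E) : ‖inclusionInDoubleDual ℝ E x‖ = ‖x‖ :=
  (inclusionInDoubleDualLi (E := E) ℝ).norm_map x

theorem inclusionInDoubleDual_mem_stateSpace {z : E} {f : E⋆} (hf : f ∈ stateSpace z) :
    inclusionInDoubleDual ℝ E⋆ f ∈ stateSpace (inclusionInDoubleDual ℝ E z) :=
  ⟨(double_dual_bound ℝ _ f).trans hf.1,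
    hf.2.trans (norm_inclusionInDoubleDual z).symm⟩

/-- At a very smooth point the support functional depends continuously on approximate norming
data, for the weak topology of the dual. -/
theorem IsVerySmoothPoint.tendsto_weak {z : E} (hz : IsVerySmoothPoint z) {f : E⋆}
    (hf : f ∈ stateSpace z) {ι : Type*} {l : Filter ι} {u : ι → E⋆} (hu : ∀ i, ‖u i‖ ≤ 1)
    (hlim : Tendsto (fun i => u i z) l (𝓝 ‖z‖)) (G : E⋆⋆) :
    Tendsto (fun i => G (u i)) l (𝓝 (G f)) := by
  obtain ⟨-, -, F₀, hF₀⟩ := hz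
  -- Along each ultrafilter a limit exists in the third dual, and smoothness in the bidual leaves
  -- only one candidate for it.
  refine (tendsto_iff_ultrafilter _ _ _).2 fun U hU => ?_
  obtain ⟨Ψ, hΨ, hΨlim⟩ := exists_ultrafilter_limit U (fun i => inclusionInDoubleDual ℝ E⋆ (u i)) 1
    fun i => (double_dual_bound ℝ _ _).trans (hu i)
  have hΨz : Ψ (inclusionInDoubleDual ℝ E z) = ‖inclusionInDoubleDual ℝ E z‖ :=
    (tendsto_nhds_unique (hΨlim (inclusionInDoubleDual ℝ E z)) (hlim.mono_left hU)).trans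
      (norm_inclusionInDoubleDual z).symm
  have hΨF : Ψ = F₀ := by
    have : Ψ ∈ stateSpace (inclusionInDoubleDual ℝ E z) := ⟨hΨ, hΨz⟩
    rwa [hF₀] at this
  have hfF : inclusionInDoubleDual ℝ E⋆ f = F₀ := by
    have := inclusionInDoubleDual_mem_stateSpace hf
    rwa [hF₀] at this
  have hG := hΨlim G
  rw [hΨF, ← hfF] at hG
  exact hG

/-- Finite sets are compact, so indexing by a finite set and a precision `1 / (n + 1)` turns the
property into strong convergence of a bounded net. -/
theorem HasCompactMetricAP.exists_net (h : HasCompactMetricAP E) :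
    ∃ T : Finset E × ℕ → E →L[ℝ] E, (∀ i, IsCompactOperator (T i)) ∧ (∀ i, ‖T i‖ ≤ 1) ∧
      ∀ x, Tendsto (fun i => T i x) atTop (𝓝 x) := by
  choose T hTc hT1 hT using fun i : Finset E × ℕ =>
    h (i.1 : Set E) i.1.finite_toSet.isCompact (1 / ((i.2 : ℝ) + 1)) (by positivity)
  refine ⟨T, hTc, hT1, fun x => ?_⟩
  refine tendsto_iff_norm_sub_tendsto_zero.2 ?_
  have hlim : Tendsto (fun i : Finset E × ℕ => 1 / ((i.2 : ℝ) + 1)) atTop (𝓝 0) := by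
    rw [← prod_atTop_atTop_eq]
    exact tendsto_one_div_add_atTop_nhds_zero_nat.comp tendsto_snd
  refine squeeze_zero' (Eventually.of_forall fun _ => norm_nonneg _) ?_ hlim
  filter_upwards [eventually_ge_atTop (({x} : Finset E), 0)] with i hi
  exact hT i x (by simpa using hi.1)

theorem exists_apply_ne_zero {φ : E⋆} (h : φ ≠ 0) : ∃ v, φ v ≠ 0 := by
  by_contra! h0
  exact h (ContinuousLinearMap.ext h0)

theorem exists_seq_tendsto_opNorm (g : E⋆) :
    ∃ u : ℕ → E, (∀ n, ‖u n‖ ≤ 1) ∧ Tendsto (fun n => g (u n)) atTop (𝓝 ‖g‖) := by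
  have key : ∀ n : ℕ, ∃ x : E, ‖x‖ ≤ 1 ∧ ‖g‖ - 1 / ((n : ℝ) + 1) ≤ g x := by
    intro n
    have hn : (0 : ℝ) < 1 / ((n : ℝ) + 1) := by positivity
    obtain ⟨x, hx, hgx⟩ := g.exists_lt_apply_of_lt_opNorm (sub_lt_self ‖g‖ hn)
    rcases le_total 0 (g x) with h0 | h0
    · exact ⟨x, hx.le, by rw [Real.norm_of_nonneg h0] at hgx; exact hgx.le⟩
    · exact ⟨-x, by simpa using hx.le, by
        rw [Real.norm_of_nonpos h0] at hgx; simpa using hgx.le⟩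
  choose u hu hgu using key
  refine ⟨u, hu, tendsto_of_tendsto_of_tendsto_of_le_of_le ?_ tendsto_const_nhds hgu fun n => ?_⟩
  · simpa using tendsto_const_nhds.sub (tendsto_one_div_add_atTop_nhds_zero_nat (𝕜 := ℝ))
  · exact (le_abs_self _).trans ((g.le_opNorm (u n)).trans
      (mul_le_of_le_one_right (norm_nonneg _) (hu n)))

/-- The norm of a compact operator is approached along a sequence of unit ball vectors with norm
convergent images. -/
theorem IsCompactOperator.exists_seq_tendsto_norm {T : E →L[ℝ] F} (hT : IsCompactOperator T) :
    ∃ (u : ℕ → E) (g : F), (∀ n, ‖u n‖ ≤ 1) ∧ ‖g‖ = ‖T‖ ∧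
      Tendsto (fun n => T (u n)) atTop (𝓝 g) := by
  have key : ∀ n : ℕ, ∃ x : E, ‖x‖ ≤ 1 ∧ ‖T‖ - 1 / ((n : ℝ) + 1) ≤ ‖T x‖ := by
    intro n
    have hn : (0 : ℝ) < 1 / ((n : ℝ) + 1) := by positivity
    obtain ⟨x, hx, hgx⟩ := T.exists_lt_apply_of_lt_opNorm (sub_lt_self ‖T‖ hn)
    exact ⟨x, hx.le, hgx.le⟩
  choose u hu hTu using key
  obtain ⟨K, hK, hTK⟩ := hT.image_closedBall_subset_compact (f := (T : E →ₗ[ℝ] F)) 1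
  obtain ⟨g, -, φ, hφ, hlim⟩ := hK.tendsto_subseq (x := fun n => T (u n))
    fun n => hTK ⟨u n, by simpa using hu n, rfl⟩
  refine ⟨u ∘ φ, g, fun n => hu _, tendsto_nhds_unique hlim.norm ?_, hlim⟩
  have hnorm : Tendsto (fun n => ‖T (u n)‖) atTop (𝓝 ‖T‖) := by
    refine tendsto_of_tendsto_of_tendsto_of_le_of_le ?_ tendsto_const_nhds hTu fun n =>
      (T.le_opNorm (u n)).trans (mul_le_of_le_one_right (norm_nonneg _) (hu n))
    simpa using tendsto_const_nhds.sub (tendsto_one_div_add_atTop_nhds_zero_nat (𝕜 := ℝ))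
  exact hnorm.comp hφ.tendsto_atTop

end NormedSpaces

/-! ### Elementary tensors and rank one operators -/

section OperatorSpaces

set_option maxSynthPendingDepth 3

variable {X : Type*} [NormedAddCommGroup X] [NormedSpace ℝ X]
  {Y : Type*} [NormedAddCommGroup Y] [NormedSpace ℝ Y]

theorem abs_apply_adjointOp_le (x : X⋆⋆) (y : Y⋆⋆) (T : X →L[ℝ] Y⋆) :
    |x (adjointOp T y)| ≤ ‖x‖ * ‖y‖ * ‖T‖ := by
  have h : ‖adjointOp T y‖ ≤ ‖y‖ * ‖T‖ := ContinuousLinearMap.opNorm_comp_le y T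
  calc |x (adjointOp T y)| ≤ ‖x‖ * ‖adjointOp T y‖ := x.le_opNorm _
    _ ≤ ‖x‖ * (‖y‖ * ‖T‖) := by gcongr
    _ = _ := by ring

/-- The functional `x** ⊗ y**` on `𝒦(X, Y*)`, sending `T` to `x**(T* y**)`. -/
noncomputable def elementaryFunctional (x : X⋆⋆) (y : Y⋆⋆) : (CompactOps X Y⋆)⋆ :=
  LinearMap.mkContinuous
    { toFun := fun T => x (adjointOp (T : X →L[ℝ] Y⋆) y)
      map_add' := fun S T => by
        rw [← map_add]; congr 1; ext v; exact map_add y (S.1 v) (T.1 v)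
      map_smul' := fun c T => by
        rw [RingHom.id_apply, ← map_smul]; congr 1; ext v; exact map_smul y c (T.1 v) }
    (‖x‖ * ‖y‖) fun T => abs_apply_adjointOp_le x y T

@[simp]
theorem elementaryFunctional_apply (x : X⋆⋆) (y : Y⋆⋆) (T : CompactOps X Y⋆) :
    elementaryFunctional x y T = x (adjointOp (T : X →L[ℝ] Y⋆) y) := rfl

theorem norm_elementaryFunctional_le_one {x : X⋆⋆} {y : Y⋆⋆} (hx : ‖x‖ ≤ 1) (hy : ‖y‖ ≤ 1) :
    ‖elementaryFunctional x y‖ ≤ 1 :=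
  (LinearMap.mkContinuous_norm_le _ (by positivity) _).trans
    (mul_le_one₀ hx (norm_nonneg _) hy)

theorem isCompactOperator_smulRight (g : X⋆) (h : Y⋆) : IsCompactOperator (g.smulRight h) :=
  (isCompactOperator_of_locallyCompactSpace_dom g).clm_comp
    (ContinuousLinearMap.toSpanSingleton ℝ h)

/-- The rank one operator `g ⊗ h`, as a function of `g`. -/
noncomputable def rankOneLeft (h : Y⋆) : X⋆ →L[ℝ] CompactOps X Y⋆ :=
  LinearMap.mkContinuous
    { toFun := fun g => ⟨g.smulRight h, isCompactOperator_smulRight g h⟩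
      map_add' := fun _ _ => Subtype.ext <| by ext; simp [add_mul]
      map_smul' := fun _ _ => Subtype.ext <| by ext; simp [mul_assoc] }
    ‖h‖ fun g => by
      change ‖g.smulRight h‖ ≤ _
      rw [ContinuousLinearMap.norm_smulRight_apply, mul_comm]

/-- The rank one operator `g ⊗ h`, as a function of `h`. -/
noncomputable def rankOneRight (g : X⋆) : Y⋆ →L[ℝ] CompactOps X Y⋆ :=
  LinearMap.mkContinuous
    { toFun := fun h => ⟨g.smulRight h, isCompactOperator_smulRight g h⟩
      map_add' := fun _ _ => Subtype.ext <| by ext; simp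
      map_smul' := fun _ _ => Subtype.ext <| by ext; simp [mul_left_comm] }
    ‖g‖ fun h => by
      change ‖g.smulRight h‖ ≤ _
      rw [ContinuousLinearMap.norm_smulRight_apply]

theorem adjointOp_smulRight (g : X⋆) (h : Y⋆) (y : Y⋆⋆) :
    adjointOp (g.smulRight h) y = y h • g := by
  ext v
  simp [adjointOp_apply, mul_comm]

/-- Restricting a tensor to the operators `g ⊗ h` with `h` fixed recovers `x` up to the scalar `y
h`. This carries weak convergence of tensors over to `X**`, and gives injectivity in `x` when `y ≠
0`. -/
theorem adjointOp_rankOneLeft (h : Y⋆) (x : X⋆⋆) (y : Y⋆⋆) :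
    adjointOp (rankOneLeft (X := X) (Y := Y) h) (elementaryFunctional x y) = y h • x := by
  ext g
  change x (adjointOp (g.smulRight h) y) = _
  rw [adjointOp_smulRight]
  simp

theorem adjointOp_rankOneRight (g : X⋆) (x : X⋆⋆) (y : Y⋆⋆) :
    adjointOp (rankOneRight (X := X) (Y := Y) g) (elementaryFunctional x y) = x g • y := by
  ext h
  change x (adjointOp (g.smulRight h) y) = _
  rw [adjointOp_smulRight]
  simp [mul_comm]

theorem elementaryFunctional_left_injective {y : Y⋆⋆} (hy : y ≠ 0) {x x' : X⋆⋆}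
    (h : elementaryFunctional x y = elementaryFunctional x' y) : x = x' := by
  obtain ⟨v, hv⟩ := exists_apply_ne_zero hy
  have := congrArg (adjointOp (rankOneLeft (X := X) (Y := Y) v)) h
  rw [adjointOp_rankOneLeft, adjointOp_rankOneLeft] at this
  exact smul_right_injective _ hv this

theorem elementaryFunctional_right_injective {x : X⋆⋆} (hx : x ≠ 0) {y y' : Y⋆⋆}
    (h : elementaryFunctional x y = elementaryFunctional x y') : y = y' := by
  obtain ⟨v, hv⟩ := exists_apply_ne_zero hx
  have := congrArg (adjointOp (rankOneRight (X := X) (Y := Y) v)) h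
  rw [adjointOp_rankOneRight, adjointOp_rankOneRight] at this
  exact smul_right_injective _ hv this

/-! ### Bounded operators as bidual elements -/

/-- A bounded operator that is a pointwise weak* limit of a bounded net of compact operators is
represented, on elementary tensors, by an element of `𝒦(X, Y*)**`. -/
theorem exists_bidual_of_net {ι : Type*} {l : Filter ι} [l.NeBot] (B : X →L[ℝ] Y⋆)
    (k : ι → CompactOps X Y⋆) (C : ℝ) (hk : ∀ i, ‖k i‖ ≤ C)
    (hlim : ∀ x y, Tendsto (fun i => (k i : X →L[ℝ] Y⋆) x y) l (𝓝 (B x y))) :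
    ∃ J : (CompactOps X Y⋆)⋆⋆, ∀ x y, J (elementaryFunctional (inclusionInDoubleDual ℝ X x)
      (inclusionInDoubleDual ℝ Y y)) = B x y := by
  obtain ⟨J, -, hJ⟩ := exists_ultrafilter_limit (Ultrafilter.of l)
    (fun i => inclusionInDoubleDual ℝ (CompactOps X Y⋆) (k i)) C
    fun i => (double_dual_bound ℝ _ _).trans (hk i)
  exact ⟨J, fun x y => tendsto_nhds_unique (hJ _) ((hlim x y).mono_left (Ultrafilter.of_le l))⟩

/-- `B` factors through `X**` and through `Y***`; inserting the approximating compact operators, or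
their adjoints, into the factorization gives a bounded net of compact operators converging to `B`
pointwise weak*. -/
theorem exists_bidual_of_hasCompactMetricAP (hAP : HasCompactMetricAP X⋆⋆ ∨ HasCompactMetricAP Y⋆⋆)
    (B : X →L[ℝ] Y⋆) :
    ∃ J : (CompactOps X Y⋆)⋆⋆, ∀ x y, J (elementaryFunctional (inclusionInDoubleDual ℝ X x)
      (inclusionInDoubleDual ℝ Y y)) = B x y := by
  classical
  rcases hAP with h | h
  · obtain ⟨T, hTc, hT1, hT⟩ := h.exists_net
    -- `Q` is `B**` followed by restriction of functionals from `Y**` to `Y`, so `Q.comp R` is `B`.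
    let Q : X⋆⋆ →L[ℝ] Y⋆ := (adjointOp (inclusionInDoubleDual ℝ Y)).comp (adjointOp (adjointOp B))
    let R : X →L[ℝ] X⋆⋆ := inclusionInDoubleDual ℝ X
    refine exists_bidual_of_net (ι := Finset X⋆⋆ × ℕ) (l := atTop) B
      (fun i => ⟨Q.comp ((T i).comp R), ((hTc i).comp_clm R).clm_comp Q⟩) (‖Q‖ * (1 * ‖R‖)) ?_ ?_
    · intro i
      refine (ContinuousLinearMap.opNorm_comp_le Q _).trans ?_
      gcongr
      refine (ContinuousLinearMap.opNorm_comp_le _ R).trans ?_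
      gcongr
      exact hT1 i
    · intro x y
      have hc : Continuous fun w : X⋆⋆ => Q w y :=
        ((ContinuousLinearMap.apply ℝ ℝ y).comp Q).continuous
      exact (hc.tendsto _).comp (hT (R x))
  · obtain ⟨T, hTc, hT1, hT⟩ := h.exists_net
    -- Here `T i` acts on `Y**`, so its adjoint, compact by Schauder, is placed between `B x` in
    -- `Y***` and restriction to `Y`.
    let Q : Y⋆⋆⋆ →L[ℝ] Y⋆ := adjointOp (inclusionInDoubleDual ℝ Y)
    let R : X →L[ℝ] Y⋆⋆⋆ := (inclusionInDoubleDual ℝ Y⋆).comp B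
    refine exists_bidual_of_net (ι := Finset Y⋆⋆ × ℕ) (l := atTop) B
      (fun i => ⟨Q.comp ((adjointOp (T i)).comp R),
        (((hTc i).adjointOp).comp_clm R).clm_comp Q⟩) (‖Q‖ * (1 * ‖R‖)) ?_ ?_
    · intro i
      refine (ContinuousLinearMap.opNorm_comp_le Q _).trans ?_
      gcongr
      refine (ContinuousLinearMap.opNorm_comp_le _ R).trans ?_
      gcongr
      refine ContinuousLinearMap.opNorm_le_bound _ zero_le_one fun φ => ?_
      refine (ContinuousLinearMap.opNorm_comp_le φ (T i)).trans ?_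
      rw [one_mul]
      exact mul_le_of_le_one_right (norm_nonneg _) (hT1 i)
    · intro x y
      have hc : Continuous fun w : Y⋆⋆ => w (B x) :=
        (ContinuousLinearMap.apply ℝ ℝ (B x)).continuous
      exact (hc.tendsto _).comp (hT (inclusionInDoubleDual ℝ Y y))

/-! ### Norm attainment and extreme points -/

/-- A compact operator attains its norm at a pair of bidual vectors, the first of which is
approximately attained along a sequence in the original space. -/
theorem exists_norming_pair (A : CompactOps X Y⋆) :
    ∃ (x : X⋆⋆) (y : Y⋆⋆) (u : ℕ → X), ‖x‖ ≤ 1 ∧ ‖y‖ ≤ 1 ∧ (∀ n, ‖u n‖ ≤ 1) ∧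
      elementaryFunctional x y A = ‖A‖ ∧
      Tendsto (fun n => elementaryFunctional (inclusionInDoubleDual ℝ X (u n)) y A) atTop
        (𝓝 ‖A‖) := by
  obtain ⟨u, g, hu, hg, hlim⟩ := IsCompactOperator.exists_seq_tendsto_norm (T := A.1) A.2
  obtain ⟨y, hy, hyg⟩ := exists_dual_vector'' ℝ g
  obtain ⟨x, hx, hxA⟩ := exists_dual_vector'' ℝ (adjointOp A.1 y)
  have hlim' : Tendsto (fun n => adjointOp A.1 y (u n)) atTop (𝓝 ‖A‖) := by
    have := (y.continuous.tendsto g).comp hlim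
    rw [hyg, hg] at this
    exact this
  refine ⟨x, y, u, hx, hy, hu, ?_, hlim'⟩
  refine (hxA.trans ?_ : x (adjointOp A.1 y) = ‖A‖)
  refine le_antisymm ?_ (le_of_tendsto hlim' (Eventually.of_forall fun n => ?_))
  · refine (ContinuousLinearMap.opNorm_comp_le y A.1).trans ?_
    exact mul_le_of_le_one_left (norm_nonneg _) hy
  · exact (le_abs_self _).trans (((adjointOp A.1 y).le_opNorm (u n)).trans
      (mul_le_of_le_one_right (norm_nonneg _) (hu n)))

/-- A pair of unit vectors whose elementary functional is the only support functional of `A`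
consists of extreme points of the unit balls. -/
theorem mem_extremePoints_of_stateSpace_subsingleton {A : CompactOps X Y⋆}
    (hA : (stateSpace A).Subsingleton) {x : X⋆⋆} {y : Y⋆⋆} (hx : ‖x‖ ≤ 1) (hy : ‖y‖ ≤ 1)
    (hx0 : x ≠ 0) (hy0 : y ≠ 0) (hxy : elementaryFunctional x y A = ‖A‖) :
    x ∈ Set.extremePoints ℝ (Metric.closedBall (0 : X⋆⋆) 1) ∧
      y ∈ Set.extremePoints ℝ (Metric.closedBall (0 : Y⋆⋆) 1) := by
  have hmem : elementaryFunctional x y ∈ stateSpace A :=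
    ⟨norm_elementaryFunctional_le_one hx hy, hxy⟩
  have hle : ∀ x' : X⋆⋆, ∀ y' : Y⋆⋆, ‖x'‖ ≤ 1 → ‖y'‖ ≤ 1 → elementaryFunctional x' y' A ≤ ‖A‖ :=
    fun x' y' hx' hy' => (le_abs_self _).trans
      (((elementaryFunctional x' y').le_of_opNorm_le
        (norm_elementaryFunctional_le_one hx' hy') A).trans_eq (one_mul _))
  constructor
  · refine mem_extremePoints_iff_left.2 ⟨by simpa using hx, fun x₁ h₁ x₂ h₂ hseg => ?_⟩
    rw [mem_closedBall_zero_iff] at h₁ h₂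
    obtain ⟨a, b, ha, hb, hab, rfl⟩ := hseg
    have hsum : a * elementaryFunctional x₁ y A + b * elementaryFunctional x₂ y A = ‖A‖ := by
      simpa using hxy
    -- Both endpoint values are at most `‖A‖` and their proper convex combination equals `‖A‖`, so
    -- the endpoint also supports `A`; uniqueness and injectivity then finish.
    have h₁A : elementaryFunctional x₁ y A = ‖A‖ := by
      have e₁ := hle x₁ y h₁ hy
      have e₂ := hle x₂ y h₂ hy
      refine le_antisymm e₁ ?_
      have : a * ‖A‖ + b * ‖A‖ = ‖A‖ := by rw [← add_mul, hab, one_mul]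
      have := mul_le_mul_of_nonneg_left e₂ hb.le
      exact le_of_mul_le_mul_left (by linarith) ha
    exact elementaryFunctional_left_injective hy0
      (hA ⟨norm_elementaryFunctional_le_one h₁ hy, h₁A⟩ hmem)
  · refine mem_extremePoints_iff_left.2 ⟨by simpa using hy, fun y₁ h₁ y₂ h₂ hseg => ?_⟩
    rw [mem_closedBall_zero_iff] at h₁ h₂
    obtain ⟨a, b, ha, hb, hab, rfl⟩ := hseg
    have hsum : a * elementaryFunctional x y₁ A + b * elementaryFunctional x y₂ A = ‖A‖ := by
      simpa using hxy
    have h₁A : elementaryFunctional x y₁ A = ‖A‖ := by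
      have e₁ := hle x y₁ hx h₁
      have e₂ := hle x y₂ hx h₂
      refine le_antisymm e₁ ?_
      have : a * ‖A‖ + b * ‖A‖ = ‖A‖ := by rw [← add_mul, hab, one_mul]
      have := mul_le_mul_of_nonneg_left e₂ hb.le
      exact le_of_mul_le_mul_left (by linarith) ha
    exact elementaryFunctional_right_injective hx0
      (hA ⟨norm_elementaryFunctional_le_one hx h₁, h₁A⟩ hmem)

/-- A very smooth compact operator attains its norm at a pair of vectors of `X` and `Y`. -/
theorem IsVerySmoothPoint.exists_norming_vectors [CompleteSpace X] [CompleteSpace Y]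
    {A : CompactOps X Y⋆} (hA : IsVerySmoothPoint A) :
    ∃ (x : X) (y : Y), ‖x‖ ≤ 1 ∧ ‖y‖ ≤ 1 ∧ (A : X →L[ℝ] Y⋆) x y = ‖A‖ := by
  have hA0 : ‖A‖ ≠ 0 := norm_ne_zero_iff.2 hA.1.1
  obtain ⟨x, y, u, hx, hy, hu, hxy, hlim⟩ := exists_norming_pair A
  have hx0 : x ≠ 0 := fun h => hA0 (by rw [← hxy, h]; simp)
  have hy0 : y ≠ 0 := fun h => hA0 (by rw [← hxy, h]; simp)
  have hmem : elementaryFunctional x y ∈ stateSpace A :=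
    ⟨norm_elementaryFunctional_le_one hx hy, hxy⟩
  obtain ⟨x', rfl⟩ : ∃ x', inclusionInDoubleDual ℝ X x' = x := by
    -- The vectors `y h • u n` of `X` converge weakly to `y h • x` in `X**`, and `y h ≠ 0` allows
    -- dividing.
    obtain ⟨h, hh⟩ := exists_apply_ne_zero hy0
    have hw := Submodule.mem_of_tendsto_weak (l := atTop) _ isClosed_range_inclusionInDoubleDual
      (u := fun n => y h • inclusionInDoubleDual ℝ X (u n)) (z := y h • x)
      (fun n => ⟨y h • u n, map_smul _ _ _⟩) fun φ => by
        have := hA.tendsto_weak hmem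
          (fun n => norm_elementaryFunctional_le_one ((double_dual_bound ℝ _ _).trans (hu n)) hy)
          hlim (φ.comp (adjointOp (rankOneLeft (X := X) (Y := Y) h)))
        simpa only [ContinuousLinearMap.comp_apply, adjointOp_rankOneLeft] using this
    exact (Submodule.smul_mem_iff _ hh).1 hw
  have hx' : ‖x'‖ ≤ 1 := by rwa [norm_inclusionInDoubleDual] at hx
  have hAx : ‖A.1 x'‖ = ‖A‖ := by
    refine le_antisymm ((A.1.le_opNorm x').trans (mul_le_of_le_one_right (norm_nonneg _) hx')) ?_
    rw [← hxy]
    exact (le_abs_self _).trans ((y.le_opNorm (A.1 x')).trans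
      (mul_le_of_le_one_left (norm_nonneg _) hy))
  -- With `x'` now in `X`, `A x'` is a functional on `Y` of norm `‖A‖`, so a sequence in the ball of
  -- `Y` norms it and can replace `y`.
  obtain ⟨v, hv, hvlim⟩ := exists_seq_tendsto_opNorm (A.1 x')
  rw [hAx] at hvlim
  obtain ⟨y', rfl⟩ : ∃ y', inclusionInDoubleDual ℝ Y y' = y := by
    obtain ⟨g, hg⟩ := exists_apply_ne_zero hx0
    have hw := Submodule.mem_of_tendsto_weak (l := atTop) _ isClosed_range_inclusionInDoubleDual
      (u := fun n => inclusionInDoubleDual ℝ X x' g • inclusionInDoubleDual ℝ Y (v n))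
      (z := inclusionInDoubleDual ℝ X x' g • y)
      (fun n => ⟨inclusionInDoubleDual ℝ X x' g • v n, map_smul _ _ _⟩) fun φ => by
        have := hA.tendsto_weak hmem
          (fun n => norm_elementaryFunctional_le_one hx ((double_dual_bound ℝ _ _).trans (hv n)))
          hvlim (φ.comp (adjointOp (rankOneRight (X := X) (Y := Y) g)))
        simpa only [ContinuousLinearMap.comp_apply, adjointOp_rankOneRight] using this
    exact (Submodule.smul_mem_iff _ hg).1 hw
  exact ⟨x', y', hx', by rwa [norm_inclusionInDoubleDual] at hy, hxy⟩

/-! ### The one-sided derivative of the norm -/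

theorem exists_norm_sub_le_apply (T : X →L[ℝ] Y⋆) {ε : ℝ} (hε : 0 < ε) :
    ∃ (x : X) (y : Y), ‖x‖ ≤ 1 ∧ ‖y‖ ≤ 1 ∧ ‖T‖ - ε ≤ T x y := by
  obtain ⟨x, hx, hTx⟩ := T.exists_lt_apply_of_lt_opNorm (sub_lt_self ‖T‖ hε)
  obtain ⟨v, hv, hlim⟩ := exists_seq_tendsto_opNorm (T x)
  obtain ⟨n, hn⟩ := (hlim.eventually (lt_mem_nhds hTx)).exists
  exact ⟨x, v n, hx.le, hv n, hn.le⟩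

theorem apply_apply_le_norm (T : X →L[ℝ] Y⋆) {x : X} {y : Y} (hx : ‖x‖ ≤ 1) (hy : ‖y‖ ≤ 1) :
    T x y ≤ ‖T‖ :=
  calc T x y ≤ ‖T x‖ * ‖y‖ := (le_abs_self _).trans ((T x).le_opNorm y)
    _ ≤ ‖T x‖ := mul_le_of_le_one_right (norm_nonneg _) hy
    _ ≤ ‖T‖ * ‖x‖ := T.le_opNorm x
    _ ≤ ‖T‖ := mul_le_of_le_one_right (norm_nonneg _) hx

/-- The one-sided derivative of the operator norm at a very smooth compact operator, in a direction
represented by an element of `𝒦(X, Y*)**`. -/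
theorem IsVerySmoothPoint.tendsto_norm_add_smul {A : CompactOps X Y⋆} (hA : IsVerySmoothPoint A)
    {x : X} {y : Y} (hx : ‖x‖ ≤ 1) (hy : ‖y‖ ≤ 1) (hxy : (A : X →L[ℝ] Y⋆) x y = ‖A‖)
    (B : X →L[ℝ] Y⋆) (J : (CompactOps X Y⋆)⋆⋆)
    (hJ : ∀ x y, J (elementaryFunctional (inclusionInDoubleDual ℝ X x)
      (inclusionInDoubleDual ℝ Y y)) = B x y) :
    Tendsto (fun t : ℝ => (‖(A : X →L[ℝ] Y⋆) + t • B‖ - ‖(A : X →L[ℝ] Y⋆)‖) / t)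
      (𝓝[>] 0) (𝓝 (B x y)) := by
  have hι : ∀ {x : X} {y : Y}, ‖x‖ ≤ 1 → ‖y‖ ≤ 1 → ‖elementaryFunctional
      (inclusionInDoubleDual ℝ X x) (inclusionInDoubleDual ℝ Y y)‖ ≤ 1 := fun hx hy =>
    norm_elementaryFunctional_le_one ((double_dual_bound ℝ _ _).trans hx)
      ((double_dual_bound ℝ _ _).trans hy)
  -- The error `t ^ 2` still vanishes after division by `t`. For `t ≤ 0` the pair is a dummy,
  -- keeping the norm bounds valid for every `t`.
  have hne : ∀ t : ℝ, ∃ (v : X) (w : Y), ‖v‖ ≤ 1 ∧ ‖w‖ ≤ 1 ∧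
      (0 < t → ‖(A : X →L[ℝ] Y⋆) + t • B‖ - t ^ 2 ≤ ((A : X →L[ℝ] Y⋆) + t • B) v w) := by
    intro t
    by_cases ht : 0 < t
    · obtain ⟨v, w, hv, hw, h⟩ := exists_norm_sub_le_apply ((A : X →L[ℝ] Y⋆) + t • B)
        (pow_pos ht 2)
      exact ⟨v, w, hv, hw, fun _ => h⟩
    · exact ⟨0, 0, by simp, by simp, fun h => absurd h ht⟩
  choose v w hv hw hvw using hne
  have hpos : ∀ᶠ t : ℝ in 𝓝[>] 0, 0 < t := self_mem_nhdsWithin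
  have hlow : ∀ t : ℝ, ‖(A : X →L[ℝ] Y⋆)‖ + t * B x y ≤ ‖(A : X →L[ℝ] Y⋆) + t • B‖ := fun t => by
    have := apply_apply_le_norm ((A : X →L[ℝ] Y⋆) + t • B) hx hy
    simp only [add_apply, smul_apply, smul_eq_mul, hxy] at this
    exact this
  have hup : ∀ t : ℝ, 0 < t → ‖(A : X →L[ℝ] Y⋆) + t • B‖ - t ^ 2 ≤
      (A : X →L[ℝ] Y⋆) (v t) (w t) + t * B (v t) (w t) := fun t ht => by simpa using hvw t ht
  have hBvw : ∀ t, B (v t) (w t) ≤ ‖B‖ := fun t => apply_apply_le_norm B (hv t) (hw t)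
  have hAvw : ∀ t, (A : X →L[ℝ] Y⋆) (v t) (w t) ≤ ‖(A : X →L[ℝ] Y⋆)‖ := fun t =>
    apply_apply_le_norm _ (hv t) (hw t)
  have hnorm : Tendsto (fun t => (A : X →L[ℝ] Y⋆) (v t) (w t)) (𝓝[>] 0) (𝓝 ‖A‖) := by
    refine tendsto_of_tendsto_of_tendsto_of_le_of_le' (g := fun t : ℝ =>
      ‖A‖ + t * B x y - t ^ 2 - t * ‖B‖) ?_ tendsto_const_nhds ?_ (Eventually.of_forall hAvw)
    · have hc : Continuous fun t : ℝ => ‖A‖ + t * B x y - t ^ 2 - t * ‖B‖ := by fun_prop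
      simpa using (hc.tendsto 0).mono_left nhdsWithin_le_nhds
    · filter_upwards [hpos] with t ht
      have h₁ := hlow t
      have h₂ := hup t ht
      have h₃ := mul_le_mul_of_nonneg_left (hBvw t) ht.le
      change ‖(A : X →L[ℝ] Y⋆)‖ + _ - _ - _ ≤ _
      linarith
  -- Testing against `J` replaces continuity of `B` on tensors, since `B` itself need not be
  -- compact: it yields `B (v t) (w t) → B x y`.
  have hweak := hA.tendsto_weak ⟨hι hx hy, hxy⟩ (fun t => hι (hv t) (hw t)) hnorm J
  simp only [hJ] at hweak
  -- The quotient lies between `B x y`, from evaluating at the fixed pair, and `B (v t) (w t) + t`,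
  -- from the almost norming pair.
  refine tendsto_of_tendsto_of_tendsto_of_le_of_le' (h := fun t => B (v t) (w t) + t)
    tendsto_const_nhds ?_ ?_ ?_
  · simpa using hweak.add (tendsto_id.mono_left nhdsWithin_le_nhds : Tendsto id (𝓝[>] (0 : ℝ)) _)
  · filter_upwards [hpos] with t ht
    rw [le_div_iff₀ ht]
    linarith [hlow t]
  · filter_upwards [hpos] with t ht
    rw [div_le_iff₀ ht]
    nlinarith [hup t ht, hAvw t]

/-- The derivative formula, with the extreme points taken in the original spaces. -/
theorem IsVerySmoothPoint.exists_extremePoints_tendsto [CompleteSpace X] [CompleteSpace Y]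
    (hAP : HasCompactMetricAP X⋆⋆ ∨ HasCompactMetricAP Y⋆⋆)
    {A : CompactOps X Y⋆} (hA : IsVerySmoothPoint A) (B : X →L[ℝ] Y⋆) :
    ∃ x ∈ Set.extremePoints ℝ (Metric.closedBall (0 : X⋆⋆) 1),
    ∃ y ∈ Set.extremePoints ℝ (Metric.closedBall (0 : Y⋆⋆) 1),
      x (adjointOp (A : X →L[ℝ] Y⋆) y) = ‖(A : X →L[ℝ] Y⋆)‖ ∧
      Tendsto (fun t : ℝ => (‖(A : X →L[ℝ] Y⋆) + t • B‖ - ‖(A : X →L[ℝ] Y⋆)‖) / t)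
        (𝓝[>] 0) (𝓝 (x (adjointOp B y))) := by
  obtain ⟨x, y, hx, hy, hxy⟩ := hA.exists_norming_vectors
  obtain ⟨J, hJ⟩ := exists_bidual_of_hasCompactMetricAP hAP B
  have hA0 : ‖A‖ ≠ 0 := norm_ne_zero_iff.2 hA.1.1
  obtain ⟨f, hf⟩ := hA.1.2
  have hxy' : elementaryFunctional (inclusionInDoubleDual ℝ X x)
      (inclusionInDoubleDual ℝ Y y) A = ‖A‖ := hxy
  obtain ⟨hxe, hye⟩ := mem_extremePoints_of_stateSpace_subsingleton
    (hf ▸ Set.subsingleton_singleton) ((double_dual_bound ℝ _ _).trans hx)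
    ((double_dual_bound ℝ _ _).trans hy)
    (fun h => hA0 (by rw [← hxy', h]; simp)) (fun h => hA0 (by rw [← hxy', h]; simp)) hxy'
  exact ⟨_, hxe, _, hye, hxy, hA.tendsto_norm_add_smul hx hy hxy B J hJ⟩

end OperatorSpaces

theorem proposition14
    {X : Type*} [NormedAddCommGroup X] [NormedSpace ℝ X] [CompleteSpace X]
    {Y : Type*} [NormedAddCommGroup Y] [NormedSpace ℝ Y] [CompleteSpace Y]
    (hAP : HasCompactMetricAP X⋆⋆ ∨ HasCompactMetricAP Y⋆⋆)
    (A : CompactOps X Y⋆) (hA : IsVerySmoothPoint A)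
    (B : X →L[ℝ] Y⋆) :
    ∃ x ∈ Set.extremePoints ℝ (Metric.closedBall (0 : X⋆⋆) 1),
    ∃ y ∈ Set.extremePoints ℝ (Metric.closedBall (0 : Y⋆⋆) 1),
      x (adjointOp (A : X →L[ℝ] Y⋆) y) = ‖(A : X →L[ℝ] Y⋆)‖ ∧
      Tendsto (fun t : ℝ => (‖(A : X →L[ℝ] Y⋆) + t • B‖ - ‖(A : X →L[ℝ] Y⋆)‖) / t)
        (𝓝[>] 0) (𝓝 (x (adjointOp B y))) :=
  hA.exists_extremePoints_tendsto hAP B
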